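/- An overpartition is a partition in which the first occurrence of each part may be overlined; it has distinct parts if its non-overlined parts are pairwise distinct (the overlined ones always are). For a positive integer $n$, consider the pairs $\pi=(\lambda_1,\lambda_2)$ of non-empty overpartitions into distinct parts, the sum of all parts of $\lambda_1$ and $\lambda_2$ being $n$, such that $\lambda_1$ and $\lambda_2$ have the same smallest part $s$, this part $s$ occurs overlined in both $\lambda_1$ and $\lambda_2$, the non-overlined parts of $\lambda_1$ are $>s$, and the non-overlined parts of $\lambda_2$ lie in the interval $[s,2s)$. Let $D_0(n)$ (resp. $D_1(n)$) be the number of these pairs in which the total number of parts (overlined and non-overlined, of $\lambda_1$ and $\lambda_2$ together) is even (resp. odd). Define integers $D'(n)$ by the formal power series $$\sum_{n\ge 1} D'(n)q^n=\sum_{m\ge 1} q^{2m}\,(q^{m+1};q)_\infty^3\,(q^m;q)_m ,$$ where $(a;q)_k=\prod_{j=0}^{k-1}(1-aq^j)$ and $(a;q)_\infty=\prod_{j\ge 0}(1-aq^j)$. Then for every positive integer $n$ that is not a sum of two triangular numbers (triangular numbers being the integers $k(k+1)/2$ with $k\ge 0$, so that $0$ is included), $D'(n)=0$ and $D_0(n)=D_1(n)$.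 -/

import Mathlib

/-- An overpartition: a partition (a finite multiset of positive integers) in which the first
occurrence of each part may be overlined. `overlined` is the set of those parts whose first
occurrence is overlined. -/
@[ext]
structure Overpartition where
  parts : Multiset ℕ
  parts_pos : ∀ a ∈ parts, 0 < a
  overlined : Finset ℕ
  overlined_mem : ∀ a ∈ overlined, a ∈ parts

namespace Overpartition

/-- The sum of all parts. -/
def size (l : Overpartition) : ℕ := l.parts.sum

/-- The number of parts, overlined and non-overlined. -/
def numParts (l : Overpartition) : ℕ := Multiset.card l.parts

/-- The multiset of the non-overlined parts. -/
def nonOverlined (l : Overpartition) : Multiset ℕ := l.parts - l.overlined.val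

/-- The non-overlined parts are distinct (the overlined ones always are). -/
def HasDistinctParts (l : Overpartition) : Prop := l.nonOverlined.Nodup

/-- `s` is the smallest part of `l`; in particular `l` is not empty. -/
def IsSmallestPart (l : Overpartition) (s : ℕ) : Prop := IsLeast {a | a ∈ l.parts} s

end Overpartition

/-- The overpartition pairs `(p.1, p.2)` of `n` into distinct parts with
`s(p) = s(p.1) = s(p.2)`, this smallest part occurring overlined in both components, the
non-overlined parts of `p.1` being `> s(p)` and those of `p.2` lying in `[s(p), 2 s(p))`. -/
def pairsD (n : ℕ) : Set (Overpartition × Overpartition) :=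
  {p | p.1.size + p.2.size = n ∧ p.1.HasDistinctParts ∧ p.2.HasDistinctParts ∧
    ∃ s : ℕ, p.1.IsSmallestPart s ∧ p.2.IsSmallestPart s ∧
      s ∈ p.1.overlined ∧ s ∈ p.2.overlined ∧
      (∀ a ∈ p.1.nonOverlined, s < a) ∧
      (∀ a ∈ p.2.nonOverlined, a ∈ Set.Ico s (2 * s))}

/-- There are only finitely many overpartitions of a given size. -/
theorem Overpartition.finite_size_le (n : ℕ) : {l : Overpartition | l.size ≤ n}.Finite := by
  have hinj : Function.Injective
      (fun l : Overpartition => ((l.parts, l.overlined) : Multiset ℕ × Finset ℕ)) := by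
    intro l m h
    simp only [Prod.mk.injEq] at h
    exact Overpartition.ext h.1 h.2
  refine Set.Finite.of_finite_image (f := fun l : Overpartition =>
    ((l.parts, l.overlined) : Multiset ℕ × Finset ℕ)) ?_ hinj.injOn
  have hA : {m : Multiset ℕ | m ≤ n • (Finset.range (n + 1)).val}.Finite := Set.finite_Iic _
  have hB : {t : Finset ℕ | t ≤ Finset.range (n + 1)}.Finite := Set.finite_Iic _
  refine (hA.prod hB).subset ?_
  rintro _ ⟨l, hl, rfl⟩
  have hl' : l.parts.sum ≤ n := hl
  have hmem : ∀ a ∈ l.parts, a ≤ n := fun a ha => (Multiset.le_sum_of_mem ha).trans hl'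
  have hcard : Multiset.card l.parts ≤ n := by
    have := Multiset.card_nsmul_le_sum (s := l.parts) (a := 1) l.parts_pos
    simp only [smul_eq_mul, mul_one] at this
    exact this.trans hl'
  refine ⟨?_, ?_⟩
  · refine Multiset.le_iff_count.2 fun a => ?_
    by_cases ha : a ∈ l.parts
    · have h1 : Multiset.count a (Finset.range (n + 1)).val = 1 :=
        Multiset.count_eq_one_of_mem (Finset.range (n + 1)).nodup
          (Finset.mem_range.2 (Nat.lt_succ_of_le (hmem a ha)))
      rw [Multiset.count_nsmul, h1, mul_one]
      exact (Multiset.count_le_card a l.parts).trans hcard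
    · rw [Multiset.count_eq_zero_of_notMem ha]
      exact Nat.zero_le _
  · intro a ha
    exact Finset.mem_range.2 (Nat.lt_succ_of_le (hmem a (l.overlined_mem a ha)))

/-- The cardinalities below are those of finite sets. -/
theorem pairsD_finite (n : ℕ) : (pairsD n).Finite := by
  refine ((Overpartition.finite_size_le n).prod (Overpartition.finite_size_le n)).subset ?_
  rintro ⟨l, m⟩ ⟨h, -⟩
  exact ⟨(Nat.le_add_right _ _).trans h.le, (Nat.le_add_left _ _).trans h.le⟩

/-- The number of pairs in `pairsD n` with an even total number of parts. -/
noncomputable def D₀ (n : ℕ) : ℕ :=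
  {p ∈ pairsD n | Even (p.1.numParts + p.2.numParts)}.ncard

/-- The number of pairs in `pairsD n` with an odd total number of parts. -/
noncomputable def D₁ (n : ℕ) : ℕ :=
  {p ∈ pairsD n | Odd (p.1.numParts + p.2.numParts)}.ncard

section GeneratingFunction

open scoped PowerSeries.WithPiTopology

/-- The finite `q`-shifted factorial `(a; q)_n = ∏_{k < n} (1 - a q^k)` with `q = X`. -/
noncomputable def qFactorial (a : PowerSeries ℤ) (n : ℕ) : PowerSeries ℤ :=
  ∏ k ∈ Finset.range n, (1 - a * PowerSeries.X ^ k)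

/-- The infinite `q`-shifted factorial `(a; q)_∞ = ∏_{k ≥ 0} (1 - a q^k)` with `q = X`, the
product being taken coefficientwise. -/
noncomputable def qFactorialInf (a : PowerSeries ℤ) : PowerSeries ℤ :=
  ∏' k : ℕ, (1 - a * PowerSeries.X ^ k)

/-- The infinite product `(q^(m+1); q)_∞` converges. -/
theorem multipliable_qFactorialInf (m : ℕ) : Multipliable
    (fun k : ℕ => 1 - (PowerSeries.X : PowerSeries ℤ) ^ (m + 1) * PowerSeries.X ^ k) := by
  simp_rw [sub_eq_add_neg]
  apply PowerSeries.WithPiTopology.multipliable_one_add_of_tendsto_order_atTop_nhds_top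
  rw [ENat.tendsto_nhds_top_iff_natCast_lt]
  intro n
  filter_upwards [Filter.eventually_gt_atTop n] with k hk
  rw [PowerSeries.order_neg, ← pow_add, PowerSeries.order_X_pow]
  exact_mod_cast (by omega)

/-- The formal power series `∑_{m ≥ 1} q^{2m} (q^{m+1}; q)_∞^3 (q^m; q)_m` with `q = X`. -/
noncomputable def seriesD : PowerSeries ℤ :=
  ∑' m : ℕ+, PowerSeries.X ^ (2 * (m : ℕ)) *
    qFactorialInf (PowerSeries.X ^ ((m : ℕ) + 1)) ^ 3 *
    qFactorial (PowerSeries.X ^ (m : ℕ)) m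

/-- The series defining `seriesD` converges. -/
theorem summable_seriesD : Summable (fun m : ℕ+ => PowerSeries.X ^ (2 * (m : ℕ)) *
    qFactorialInf (PowerSeries.X ^ ((m : ℕ) + 1)) ^ 3 *
    qFactorial (PowerSeries.X ^ (m : ℕ)) m) := by
  rw [PowerSeries.WithPiTopology.summable_iff_summable_coeff]
  intro d
  refine summable_of_hasFiniteSupport ((Set.finite_Iic (Nat.succPNat d)).subset ?_)
  intro m hm
  by_contra hlt
  refine hm ?_
  have h1 : d < 2 * (m : ℕ) := by
    have h2 : ((Nat.succPNat d : ℕ+) : ℕ) < m := PNat.coe_lt_coe _ _ |>.2 (not_le.1 hlt)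
    rw [Nat.succPNat_coe] at h2
    omega
  dsimp only
  rw [mul_assoc, PowerSeries.coeff_X_pow_mul', if_neg (not_le.2 h1)]

end GeneratingFunction

/-- The coefficient of `q^n` in the series `∑_{m ≥ 1} q^{2m} (q^{m+1}; q)_∞^3 (q^m; q)_m`. -/
noncomputable def D' (n : ℕ) : ℤ := PowerSeries.coeff n seriesD

/-- The triangular numbers `0, 1, 3, 6, 10, …`. -/
def IsTriangular (t : ℕ) : Prop := ∃ k : ℕ, t = k * (k + 1) / 2

/-! Write `θ = ∑_{k≥0} (-1)^k q^{k(k+1)/2}` and `T_k = ∑_{n≥0} q^n (q^{n+1};q)_∞^2 (q^{n+k};q)_∞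
(q^{n+k};q)_n`. The heart is the closed form `2 ∑ D'(n) q^n = 2θ^2 - θ - (q;q)_∞^3`. By Jacobi's
identity the cube is supported on triangular numbers, as is `θ`, while `θ^2` is supported on sums of
two of them; hence `D'` vanishes elsewhere.

For the closed form, `T_k + q^k T_{k+1}` does not depend on `k` (a telescoping certificate,
`tripleTailSum_add_sub`), and `k → ∞` identifies it with a double-product sum that equals `θ`.
Iterating the recurrence gives `T_1 = θ^2`, and `k = 0` gives `T_0 = θ - T_1`. Comparing summands of
`T_1` and `T_0` yields twice the series plus `(q;q)_∞^3` (`two_mul_sum_seriesDTerm`).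

Expanding the products as signed sums over finite sets gives `D' = D₀ - D₁` for every `n`
(`D'_eq_D₀_sub_D₁`). Identities between infinite sums are handled as congruences of truncations
modulo `X ^ N`. -/

open PowerSeries

/-! ### Shifted factorials and their congruences modulo powers of `X`. -/

section TailProducts

open scoped PowerSeries.WithPiTopology

theorem qFactorialInf_X_pow (m : ℕ) :
    qFactorialInf (X ^ m) = (1 - X ^ m) * qFactorialInf (X ^ (m + 1)) := by
  have h := tprod_eq_zero_mul'
    (f := fun k : ℕ => 1 - (X : PowerSeries ℤ) ^ m * X ^ k) (by
      convert multipliable_qFactorialInf m using 2 with k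
      ring)
  unfold qFactorialInf
  rw [h]
  simp only [pow_zero, mul_one]
  congr 2
  funext k
  ring

theorem X_pow_dvd_prod_sub_one {ι : Type*} (s : Finset ι) (f : ι → PowerSeries ℤ) (m : ℕ)
    (h : ∀ i ∈ s, X ^ m ∣ f i - 1) : X ^ m ∣ ∏ i ∈ s, f i - 1 := by
  classical
  induction s using Finset.induction_on with
  | empty => simp
  | insert a s ha ih =>
    rw [Finset.prod_insert ha]
    have h1 := h a (Finset.mem_insert_self a s)
    have h2 := ih fun i hi => h i (Finset.mem_insert_of_mem hi)
    have : f a * ∏ i ∈ s, f i - 1 = (f a - 1) * ∏ i ∈ s, f i + (∏ i ∈ s, f i - 1) := by ring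
    rw [this]
    exact dvd_add (h1.mul_right _) h2

theorem X_pow_dvd_qFactorialInf_sub_one (m : ℕ) :
    (X : PowerSeries ℤ) ^ m ∣ qFactorialInf (X ^ m) - 1 := by
  rcases m with - | m
  · simp
  have hp := (multipliable_qFactorialInf m).hasProd
  rw [X_pow_dvd_iff]
  intro d hd
  have hc : IsClosed {f : PowerSeries ℤ | coeff d f = coeff d (1 : PowerSeries ℤ)} :=
    isClosed_singleton.preimage (WithPiTopology.continuous_coeff ℤ d)
  have hmem := hc.mem_of_tendsto hp (Filter.Eventually.of_forall fun s => by
    have := X_pow_dvd_prod_sub_one s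
      (fun k : ℕ => 1 - (X : PowerSeries ℤ) ^ (m + 1) * X ^ k) (m + 1)
      (fun i _ => ⟨-X ^ i, by ring⟩)
    have := X_pow_dvd_iff.1 this d hd
    rwa [map_sub, sub_eq_zero] at this)
  rw [map_sub, sub_eq_zero]
  exact hmem

end TailProducts

/-- `(q^m; q)_∞`. -/
noncomputable abbrev tailProd (m : ℕ) : PowerSeries ℤ := qFactorialInf (X ^ m)

/-- `(q^m; q)_n`. -/
noncomputable abbrev shiftProd (m n : ℕ) : PowerSeries ℤ := qFactorial (X ^ m) n

theorem tailProd_eq (m : ℕ) : tailProd m = (1 - X ^ m) * tailProd (m + 1) :=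
  qFactorialInf_X_pow m

theorem tailProd_zero : tailProd 0 = 0 := by
  rw [tailProd_eq]; simp

theorem shiftProd_zero (m : ℕ) : shiftProd m 0 = 1 := by
  simp [shiftProd, qFactorial]

theorem shiftProd_succ (m n : ℕ) :
    shiftProd m (n + 1) = shiftProd m n * (1 - X ^ (m + n)) := by
  simp only [shiftProd, qFactorial, Finset.prod_range_succ, pow_add]

theorem shiftProd_succ' (m n : ℕ) :
    shiftProd m (n + 1) = (1 - X ^ m) * shiftProd (m + 1) n := by
  simp only [shiftProd, qFactorial, Finset.prod_range_succ', pow_zero, mul_one]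
  rw [mul_comm]
  congr 1
  refine Finset.prod_congr rfl fun k _ => ?_
  ring

theorem X_pow_dvd_shiftProd_sub_one (m n : ℕ) : X ^ m ∣ shiftProd m n - 1 :=
  X_pow_dvd_prod_sub_one _ _ _ fun k _ => ⟨-X ^ k, by ring⟩

theorem shiftProd_mul_tailProd (m n : ℕ) :
    shiftProd m n * tailProd (m + n) = tailProd m := by
  induction n with
  | zero => simp [shiftProd_zero]
  | succ n ih =>
    rw [shiftProd_succ, mul_assoc, ← add_assoc, ← tailProd_eq, ih]

/-! ### The partial theta function and the double-product sum. -/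

/-- The triangular number `0 + 1 + ⋯ + k`. -/
def triangle (k : ℕ) : ℕ := k * (k + 1) / 2

theorem triangle_zero : triangle 0 = 0 := rfl

theorem triangle_succ (k : ℕ) : triangle (k + 1) = triangle k + (k + 1) := by
  unfold triangle
  rw [show (k + 1) * (k + 1 + 1) = k * (k + 1) + (k + 1) * 2 by ring,
    Nat.add_mul_div_right _ _ two_pos]

theorem le_triangle (k : ℕ) : k ≤ triangle k := by
  cases k with
  | zero => simp
  | succ k => rw [triangle_succ]; omega

theorem isTriangular_triangle (k : ℕ) : IsTriangular (triangle k) := ⟨k, rfl⟩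

/-- The first `N` terms of the partial theta function `∑_{k ≥ 0} (-1)^k q^{k(k+1)/2}`. -/
noncomputable def partialTheta (N : ℕ) : PowerSeries ℤ :=
  ∑ k ∈ Finset.range N, (-1) ^ k * X ^ triangle k

/-- Iterating `f k ≡ c - X ^ k * f (k + 1)` from `k = 1` accumulates the exponents `0, 1, 1 + 2, …`.
This is where triangular numbers enter. -/
theorem X_pow_dvd_sub_partialTheta_mul {N : ℕ} {f : ℕ → PowerSeries ℤ} {c : PowerSeries ℤ}
    (h : ∀ k, X ^ N ∣ f k + X ^ k * f (k + 1) - c) :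
    X ^ N ∣ f 1 - partialTheta N * c := by
  have key : ∀ M, X ^ N ∣
      f 1 - partialTheta M * c - (-1) ^ M * X ^ triangle M * f (M + 1) := by
    intro M
    induction M with
    | zero => simp [partialTheta, triangle_zero]
    | succ M ih =>
      have h1 := (h (M + 1)).mul_left ((-1) ^ M * X ^ triangle M)
      convert dvd_add ih h1 using 1
      rw [partialTheta, partialTheta, Finset.sum_range_succ, triangle_succ]
      ring
  have h2 : X ^ N ∣ (-1) ^ N * X ^ triangle N * f (N + 1) :=
    ((pow_dvd_pow X (le_triangle N)).mul_left _).mul_right _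
  simpa using dvd_add (key N) h2

/-- Partial sums of `∑ q^n (q^{n+1}; q)_∞ (q^{n+k}; q)_∞`. -/
noncomputable def doubleTailSum (N k : ℕ) : PowerSeries ℤ :=
  ∑ n ∈ Finset.range N, X ^ n * tailProd (n + 1) * tailProd (n + k)

theorem X_pow_dvd_mul_sub_one {a b : PowerSeries ℤ} {N : ℕ} (ha : X ^ N ∣ a - 1)
    (hb : X ^ N ∣ b - 1) : X ^ N ∣ a * b - 1 := by
  have : a * b - 1 = (a - 1) * b + (b - 1) := by ring
  rw [this]
  exact dvd_add (ha.mul_right _) hb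

theorem X_pow_dvd_tailProd_sub_one {N m : ℕ} (h : N ≤ m) : X ^ N ∣ tailProd m - 1 :=
  (pow_dvd_pow X h).trans (X_pow_dvd_qFactorialInf_sub_one m)

/-- The combined summand is the forward difference of `tailProd n * tailProd (n + k)`, whose lower
endpoint vanishes because `tailProd 0 = 0`. -/
theorem doubleTailSum_add (N k : ℕ) :
    doubleTailSum N k + X ^ k * doubleTailSum N (k + 1) = tailProd N * tailProd (N + k) := by
  have h : ∀ n ∈ Finset.range N, X ^ n * tailProd (n + 1) * tailProd (n + k) +
      X ^ k * (X ^ n * tailProd (n + 1) * tailProd (n + (k + 1))) =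
      tailProd (n + 1) * tailProd (n + 1 + k) - tailProd n * tailProd (n + k) := by
    intro n _
    rw [tailProd_eq n, tailProd_eq (n + k), show n + (k + 1) = n + k + 1 by ring,
      show n + 1 + k = n + k + 1 by ring]
    ring
  rw [doubleTailSum, doubleTailSum, Finset.mul_sum, ← Finset.sum_add_distrib,
    Finset.sum_congr rfl h,
    Finset.sum_range_sub (fun n => tailProd n * tailProd (n + k)), tailProd_zero]
  ring

theorem X_pow_dvd_doubleTailSum_one (N : ℕ) :
    X ^ N ∣ doubleTailSum N 1 - partialTheta N := by
  have := X_pow_dvd_sub_partialTheta_mul (N := N) (f := doubleTailSum N) (c := 1) fun k => by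
    rw [doubleTailSum_add]
    exact X_pow_dvd_mul_sub_one (X_pow_dvd_tailProd_sub_one le_rfl)
      (X_pow_dvd_tailProd_sub_one (by omega))
  simpa using this

/-! ### The triple-product sum and its value as a square of the partial theta function. -/

/-- Partial sums of `∑ q^n (q^{n+1}; q)_∞^2 (q^{n+k}; q)_∞ (q^{n+k}; q)_n`. -/
noncomputable def tripleTailSum (N k : ℕ) : PowerSeries ℤ :=
  ∑ n ∈ Finset.range N,
    X ^ n * tailProd (n + 1) ^ 2 * tailProd (n + k) * shiftProd (n + k) n

/-- The telescoping certificate for `tripleTailSum N k + q^k tripleTailSum N (k + 1)`. -/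
noncomputable def tripleTailCert (k n : ℕ) : PowerSeries ℤ :=
  X ^ (k + n) * tailProd n ^ 2 * tailProd (n + k + 1) * shiftProd (n + k + 1) (n - 1)

/-- Creative telescoping in `n`. The certificate vanishes at `n = 0` because `tailProd 0 = 0`, so
the truncated `n - 1` there is harmless; at `n = N` it carries the factor `X ^ N`. -/
theorem tripleTailSum_add_sub (N k : ℕ) :
    tripleTailSum N k + X ^ k * tripleTailSum N (k + 1) -
      (tripleTailSum N (k + 1) + X ^ (k + 1) * tripleTailSum N (k + 2)) =
      -tripleTailCert k N := by
  induction N with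
  | zero => simp [tripleTailSum, tripleTailCert, tailProd_zero]
  | succ N ih =>
    simp only [tripleTailSum, Finset.sum_range_succ] at ih ⊢
    rw [← sub_eq_zero] at ih ⊢
    refine Eq.trans ?_ ih
    rw [← sub_eq_zero]
    rcases N with - | n
    · simp only [tripleTailCert, Finset.range_zero, Finset.sum_empty, shiftProd_zero, zero_add,
        tailProd_zero, tailProd_eq k, add_zero, Nat.sub_self]
      rw [tailProd_eq (k + 1), show 1 + k + 1 = k + 2 by ring]
      ring
    · simp only [tripleTailCert, Nat.add_sub_cancel]
      rw [show n + 1 + (k + 1) = n + k + 2 by ring, show n + 1 + (k + 2) = n + k + 3 by ring,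
        show n + 1 + 1 + k + 1 = n + k + 3 by ring, show n + 1 + k + 1 = n + k + 2 by ring,
        show n + 1 + k = n + k + 1 by ring, show n + 1 + 1 = n + 2 by ring,
        shiftProd_succ' (n + k + 1) n, tailProd_eq (n + 1), tailProd_eq (n + k + 1),
        show n + k + 1 + 1 = n + k + 2 by ring, tailProd_eq (n + k + 2)]
      -- For positive `n` all finite products share a common core, to which they are reduced by
      -- peeling end factors; for `n = 0` they are too short for this.
      rcases n with - | n
      · simp only [shiftProd_zero, shiftProd_succ]
        ring
      · rw [shiftProd_succ' (_ + 2) n, shiftProd_succ (_ + 2) (n + 1), shiftProd_succ' (_ + 2) n,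
          shiftProd_succ (_ + 3) (n + 1), shiftProd_succ (_ + 3) n]
        ring

/-- Invariance in `k` allows replacing `k` by `k + N`, where modulo `X ^ N` the `k`-dependent
factors become `1` and the second term disappears. -/
theorem X_pow_dvd_tripleTailSum_add (N k : ℕ) :
    X ^ N ∣ tripleTailSum N k + X ^ k * tripleTailSum N (k + 1) - partialTheta N := by
  have step : ∀ k, X ^ N ∣ tripleTailSum N k + X ^ k * tripleTailSum N (k + 1) -
      (tripleTailSum N (k + 1) + X ^ (k + 1) * tripleTailSum N (k + 2)) := by
    intro k
    rw [tripleTailSum_add_sub, dvd_neg, tripleTailCert, pow_add]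
    exact ((Dvd.intro_left _ rfl).mul_right _ |>.mul_right _).mul_right _
  have chain : ∀ j, X ^ N ∣ tripleTailSum N k + X ^ k * tripleTailSum N (k + 1) -
      (tripleTailSum N (k + j) + X ^ (k + j) * tripleTailSum N (k + j + 1)) := by
    intro j
    induction j with
    | zero => simp
    | succ j ih =>
      convert dvd_add ih (step (k + j)) using 1
      simp only [add_assoc]
      ring
  have limit : X ^ N ∣ tripleTailSum N (k + N) - doubleTailSum N 1 := by
    rw [tripleTailSum, doubleTailSum, ← Finset.sum_sub_distrib]
    refine Finset.dvd_sum fun n _ => ?_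
    have h1 : X ^ N ∣ tailProd (n + (k + N)) * shiftProd (n + (k + N)) n - 1 :=
      X_pow_dvd_mul_sub_one (X_pow_dvd_tailProd_sub_one (by omega))
        ((pow_dvd_pow X (by omega)).trans (X_pow_dvd_shiftProd_sub_one _ _))
    convert h1.mul_left (X ^ n * tailProd (n + 1) ^ 2) using 1
    ring
  have small : X ^ N ∣ X ^ (k + N) * tripleTailSum N (k + N + 1) :=
    (pow_dvd_pow X (by omega)).mul_right _
  convert dvd_add (dvd_add (dvd_add (chain N) limit) small) (X_pow_dvd_doubleTailSum_one N)
    using 1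
  ring

theorem X_pow_dvd_tripleTailSum_one (N : ℕ) :
    X ^ N ∣ tripleTailSum N 1 - partialTheta N * partialTheta N :=
  X_pow_dvd_sub_partialTheta_mul fun k => X_pow_dvd_tripleTailSum_add N k

/-- The summand of `seriesD`. -/
noncomputable def seriesDTerm (m : ℕ) : PowerSeries ℤ :=
  X ^ (2 * m) * tailProd (m + 1) ^ 3 * shiftProd m m

/-- Termwise this is `(1 - q^{2m}) - (1 - q^m)^2 = 2 q^m (1 - q^m)` after removing common factors.
The cube is the `n = 0` term of `tripleTailSum (N + 1) 1`; that of `tripleTailSum (N + 1) 0` is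
zero. -/
theorem two_mul_sum_seriesDTerm (N : ℕ) :
    2 * ∑ m ∈ Finset.range N, seriesDTerm (m + 1) =
      tripleTailSum (N + 1) 1 - tripleTailSum (N + 1) 0 - tailProd 1 ^ 3 := by
  rw [tripleTailSum, tripleTailSum, ← Finset.sum_sub_distrib, Finset.sum_range_succ',
    Finset.mul_sum]
  have h : ∀ m ∈ Finset.range N, 2 * seriesDTerm (m + 1) =
      X ^ (m + 1) * tailProd (m + 1 + 1) ^ 2 * tailProd (m + 1 + 1) *
        shiftProd (m + 1 + 1) (m + 1) -
      X ^ (m + 1) * tailProd (m + 1 + 1) ^ 2 * tailProd (m + 1 + 0) *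
        shiftProd (m + 1 + 0) (m + 1) := by
    intro m _
    rw [seriesDTerm, add_zero, shiftProd_succ (m + 1 + 1) m, shiftProd_succ' (m + 1) m,
      tailProd_eq (m + 1)]
    ring
  rw [Finset.sum_congr rfl h]
  simp only [tailProd_zero, shiftProd_zero, zero_add, add_zero]
  ring

/-! ### Jacobi's identity for the cube of `(q; q)_∞` -/

/-- `q^{k(k+1)/2} (q^{n-k+1}; q)_∞ (q^{n+k+2}; q)_∞`, which vanishes for `k > n`. -/
noncomputable def jacobiTerm (n k : ℕ) : PowerSeries ℤ :=
  X ^ triangle k * tailProd (n + 1 - k) * tailProd (n + k + 2)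

theorem jacobiTerm_eq_zero {n k : ℕ} (h : n < k) : jacobiTerm n k = 0 := by
  rw [jacobiTerm, Nat.sub_eq_zero_of_le h, tailProd_zero]
  ring

theorem jacobiTerm_zero_rec (n : ℕ) :
    (1 - X ^ (2 * n + 3)) * (1 - X ^ (2 * n + 2)) * jacobiTerm (n + 1) 0 =
      (1 + X ^ (2 * n + 2)) * jacobiTerm n 0 +
        X ^ (n + 1) * (jacobiTerm n 0 + jacobiTerm n 1) := by
  simp only [jacobiTerm, triangle, Nat.sub_zero, Nat.add_sub_cancel]
  rw [tailProd_eq n, tailProd_eq (n + 1), tailProd_eq (n + 1 + 1)]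
  norm_num
  ring

/-- Up to the factor `(q;q)_∞^2 / (q;q)_{2n+1}`, `jacobiTerm n k` is `q^{k(k+1)/2}` times the
Gaussian binomial `[2n+1, n-k]`; this is the `q`-Pascal rule applied twice. -/
theorem jacobiTerm_succ_rec (n k : ℕ) :
    (1 - X ^ (2 * n + 3)) * (1 - X ^ (2 * n + 2)) * jacobiTerm (n + 1) (k + 1) =
      (1 + X ^ (2 * n + 2)) * jacobiTerm n (k + 1) +
        X ^ (n + 1) * (jacobiTerm n k + jacobiTerm n (k + 2)) := by
  rcases lt_trichotomy k n with h | h | h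
  · obtain ⟨d, rfl⟩ := Nat.exists_eq_add_of_lt h
    simp only [jacobiTerm, triangle_succ]
    rw [show k + d + 1 + 1 + 1 - (k + 1) = d + 2 by omega,
      show k + d + 1 + 1 - (k + 1) = d + 1 by omega, show k + d + 1 + 1 - k = d + 2 by omega,
      show k + d + 1 + 1 - (k + 2) = d by omega, tailProd_eq d, tailProd_eq (d + 1),
      show k + d + 1 + k + 2 = 2 * k + d + 3 by ring,
      show k + d + 1 + (k + 1) + 2 = 2 * k + d + 4 by ring,
      show k + d + 1 + (k + 2) + 2 = 2 * k + d + 5 by ring,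
      show k + d + 1 + 1 + (k + 1) + 2 = 2 * k + d + 5 by ring,
      tailProd_eq (2 * k + d + 3), tailProd_eq (2 * k + d + 3 + 1)]
    ring
  · subst h
    rw [jacobiTerm_eq_zero (n := k) (k := k + 1) (by omega),
      jacobiTerm_eq_zero (n := k) (k := k + 2) (by omega), jacobiTerm, jacobiTerm,
      triangle_succ, show k + 1 + 1 - (k + 1) = 1 by omega, show k + 1 - k = 1 by omega,
      show k + 1 + (k + 1) + 2 = 2 * k + 4 by ring, show k + k + 2 = 2 * k + 2 by ring,
      tailProd_eq (2 * k + 2), tailProd_eq (2 * k + 2 + 1)]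
    ring
  · rw [jacobiTerm_eq_zero (by omega), jacobiTerm_eq_zero (by omega),
      jacobiTerm_eq_zero (by omega), jacobiTerm_eq_zero (by omega)]
    ring

/-- `∑_{k < M} (-1)^k (2k+1) q^{k(k+1)/2} (q^{n-k+1}; q)_∞ (q^{n+k+2}; q)_∞`. -/
noncomputable def jacobiCubeSum (n M : ℕ) : PowerSeries ℤ :=
  ∑ k ∈ Finset.range M, (-1) ^ k * (2 * (k : PowerSeries ℤ) + 1) * jacobiTerm n k

theorem jacobiCubeSum_succ (n M : ℕ) : jacobiCubeSum n (M + 1) =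
    jacobiCubeSum n M + (-1) ^ M * (2 * (M : PowerSeries ℤ) + 1) * jacobiTerm n M :=
  Finset.sum_range_succ _ _

theorem jacobiCubeSum_eq_of_lt {n M : ℕ} (h : n < M) : jacobiCubeSum n M = jacobiCubeSum n (n + 1) := by
  refine (Finset.sum_subset (Finset.range_mono h) fun k _ hk => ?_).symm
  rw [jacobiTerm_eq_zero (by simpa using hk), mul_zero]

/-- The weights are linear in `k`, so `(2k + 3) + (2k - 1) = 2(2k + 1)` and the recurrence collapses
to `1 - 2q^{n+1} + q^{2n+2}`, up to boundary terms at `M`. At `k = 0` the reflection `k ↦ -1 - k`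
supplies the missing neighbour. -/
theorem jacobiCubeSum_succ_left_aux (n M : ℕ) :
    (1 - X ^ (2 * n + 3)) * (1 - X ^ (2 * n + 2)) * jacobiCubeSum (n + 1) (M + 1) =
      (1 - X ^ (n + 1)) ^ 2 * jacobiCubeSum n (M + 1) +
      (-1) ^ M * X ^ (n + 1) * ((2 * (M : PowerSeries ℤ) + 3) * jacobiTerm n M +
        (2 * (M : PowerSeries ℤ) + 1) * jacobiTerm n (M + 1)) := by
  induction M with
  | zero =>
    simp only [jacobiCubeSum, Finset.sum_range_succ, Finset.sum_range_zero, zero_add]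
    have := jacobiTerm_zero_rec n
    push_cast
    linear_combination this
  | succ M ih =>
    rw [jacobiCubeSum_succ (n + 1) (M + 1), jacobiCubeSum_succ n (M + 1)]
    have := jacobiTerm_succ_rec n M
    push_cast
    linear_combination ih + (-1) ^ (M + 1) * (2 * (M : PowerSeries ℤ) + 3) * this

theorem jacobiCubeSum_succ_left (n : ℕ) :
    (1 - X ^ (2 * n + 3)) * (1 - X ^ (2 * n + 2)) * jacobiCubeSum (n + 1) (n + 2) =
      (1 - X ^ (n + 1)) ^ 2 * jacobiCubeSum n (n + 1) := by
  rw [jacobiCubeSum_succ_left_aux n (n + 1), jacobiTerm_eq_zero (by omega),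
    jacobiTerm_eq_zero (by omega), jacobiCubeSum_eq_of_lt (n := n) (M := n + 1 + 1) (by omega)]
  ring

/-- A finite form of Jacobi's identity with denominators cleared: the sum is `(q;q)_n^2 (q;q)_∞^2 /
(q;q)_{2n+1}`, which tends to `(q;q)_∞^3`. -/
theorem jacobiCubeSum_mul (n : ℕ) :
    tailProd (n + 1) ^ 2 * shiftProd 1 (2 * n + 1) * jacobiCubeSum n (n + 1) = tailProd 1 ^ 4 := by
  induction n with
  | zero =>
    simp only [jacobiCubeSum, jacobiTerm, triangle_zero, shiftProd_succ, shiftProd_zero,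
      Finset.sum_range_succ, Finset.sum_range_zero, zero_add, mul_zero]
    norm_num
    rw [tailProd_eq 1]
    ring
  | succ n ih =>
    rw [← ih, show 2 * (n + 1) + 1 = 2 * n + 1 + 1 + 1 by ring, shiftProd_succ, shiftProd_succ,
      tailProd_eq (n + 1)]
    linear_combination tailProd (n + 1 + 1) ^ 2 * shiftProd 1 (2 * n + 1) * jacobiCubeSum_succ_left n

theorem isUnit_tailProd_succ (m : ℕ) : IsUnit (tailProd (m + 1)) := by
  rw [isUnit_iff_constantCoeff]
  have h := (X_pow_dvd_iff.1 (X_pow_dvd_qFactorialInf_sub_one (m + 1))) 0 (Nat.succ_pos m)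
  rw [map_sub, sub_eq_zero, coeff_zero_eq_constantCoeff_apply,
    coeff_zero_eq_constantCoeff_apply, map_one] at h
  rw [h]
  exact isUnit_one

/-- **Jacobi's identity**: `(q; q)_∞^3 = ∑_{k ≥ 0} (-1)^k (2k+1) q^{k(k+1)/2}`. -/
theorem X_pow_dvd_tailProd_one_pow_three (n : ℕ) :
    X ^ n ∣ tailProd 1 ^ 3 - ∑ k ∈ Finset.range (n + 1),
      (-1) ^ k * (2 * (k : PowerSeries ℤ) + 1) * X ^ triangle k := by
  have h1 : X ^ n ∣ jacobiCubeSum n (n + 1) - ∑ k ∈ Finset.range (n + 1),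
      (-1) ^ k * (2 * (k : PowerSeries ℤ) + 1) * X ^ triangle k := by
    rw [jacobiCubeSum, ← Finset.sum_sub_distrib]
    refine Finset.dvd_sum fun k hk => ?_
    have hk' := Finset.mem_range.1 hk
    have h2 : (X : PowerSeries ℤ) ^ (n - k) ∣ tailProd (n + 1 - k) * tailProd (n + k + 2) - 1 :=
      X_pow_dvd_mul_sub_one (X_pow_dvd_tailProd_sub_one (by omega))
        (X_pow_dvd_tailProd_sub_one (by omega))
    -- The tail products are `1` only modulo `X ^ (n - k)`; the missing `k` comes from `k ≤ triangle
    -- k`.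
    have h3 : (X : PowerSeries ℤ) ^ n ∣ X ^ triangle k *
        (tailProd (n + 1 - k) * tailProd (n + k + 2) - 1) := by
      refine dvd_trans ?_ (mul_dvd_mul_left _ h2)
      rw [← pow_add]
      have := le_triangle k
      exact pow_dvd_pow X (by omega)
    convert h3.mul_left ((-1) ^ k * (2 * (k : PowerSeries ℤ) + 1)) using 1
    rw [jacobiTerm]
    ring
  have h5 : X ^ n ∣ tailProd 1 * (tailProd 1 ^ 3 - jacobiCubeSum n (n + 1)) := by
    have h6 : X ^ n ∣ tailProd (1 + (2 * n + 1)) - 1 := X_pow_dvd_tailProd_sub_one (by omega)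
    have h7 := X_pow_dvd_mul_sub_one (X_pow_dvd_tailProd_sub_one (show n ≤ n + 1 by omega))
      (X_pow_dvd_tailProd_sub_one (show n ≤ n + 1 by omega))
    have e1 := jacobiCubeSum_mul n
    have e2 := shiftProd_mul_tailProd 1 (2 * n + 1)
    convert dvd_sub (h7.mul_left (shiftProd 1 (2 * n + 1) * jacobiCubeSum n (n + 1)))
      (h6.mul_left (shiftProd 1 (2 * n + 1) * jacobiCubeSum n (n + 1))) using 1
    linear_combination -e1 + jacobiCubeSum n (n + 1) * e2
  have h8 := ((isUnit_tailProd_succ 0).dvd_mul_left).1 h5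
  convert dvd_add h8 h1 using 1
  ring

/-! ### Vanishing of the coefficients of `seriesD`. -/

section Coefficients

open scoped PowerSeries.WithPiTopology

theorem D'_eq_coeff_sum (n : ℕ) :
    D' n = coeff n (∑ m ∈ Finset.range n, seriesDTerm (m + 1)) := by
  have h := ((WithPiTopology.hasSum_iff_hasSum_coeff ℤ).1 summable_seriesD.hasSum n).tsum_eq
  have h' : D' n = ∑' m : ℕ+, coeff n (seriesDTerm m) := h.symm
  rw [h', tsum_pnat_eq_tsum_succ (f := fun m => coeff n (seriesDTerm m)), map_sum]
  refine tsum_eq_sum fun m hm => ?_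
  rw [Finset.mem_range, not_lt] at hm
  rw [seriesDTerm, mul_assoc, coeff_X_pow_mul', if_neg (by omega)]

end Coefficients

theorem coeff_eq_of_X_pow_dvd_sub {f g : PowerSeries ℤ} {n N : ℕ} (h : X ^ N ∣ f - g)
    (hn : n < N) : coeff n f = coeff n g := by
  have := X_pow_dvd_iff.1 h n hn
  rwa [map_sub, sub_eq_zero] at this

theorem coeff_neg_one_pow_mul_X_pow {n k t : ℕ} (h : n ≠ t) :
    coeff n ((-1 : PowerSeries ℤ) ^ k * X ^ t) = 0 := by
  rw [show (-1 : PowerSeries ℤ) ^ k = C ((-1) ^ k) by simp, coeff_C_mul, coeff_X_pow, if_neg h,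
    mul_zero]

theorem D'_eq_zero (n : ℕ) (h : ¬ ∃ a b : ℕ, IsTriangular a ∧ IsTriangular b ∧ n = a + b) :
    D' n = 0 := by
  have h1 : ∀ k, n ≠ triangle k := fun k hk =>
    h ⟨triangle k, 0, isTriangular_triangle k, isTriangular_triangle 0, hk⟩
  have h2 : ∀ j k, n ≠ triangle j + triangle k := fun j k hk =>
    h ⟨_, _, isTriangular_triangle j, isTriangular_triangle k, hk⟩
  have hθ : coeff n (partialTheta (n + 1)) = 0 := by
    rw [partialTheta, map_sum]
    exact Finset.sum_eq_zero fun k _ => coeff_neg_one_pow_mul_X_pow (h1 k)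
  have hθθ : coeff n (partialTheta (n + 1) * partialTheta (n + 1)) = 0 := by
    rw [partialTheta, Finset.sum_mul_sum, map_sum]
    refine Finset.sum_eq_zero fun j _ => ?_
    rw [map_sum]
    refine Finset.sum_eq_zero fun k _ => ?_
    convert coeff_neg_one_pow_mul_X_pow (k := j + k) (h2 j k) using 2
    ring
  have hE : coeff n (tailProd 1 ^ 3) = 0 := by
    rw [coeff_eq_of_X_pow_dvd_sub (X_pow_dvd_tailProd_one_pow_three (n + 1)) (Nat.lt_succ_self n),
      map_sum]
    refine Finset.sum_eq_zero fun k _ => ?_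
    rw [show (-1 : PowerSeries ℤ) ^ k * (2 * (k : PowerSeries ℤ) + 1) * X ^ triangle k =
      C (2 * (k : ℤ) + 1) * ((-1) ^ k * X ^ triangle k) by simp; ring, coeff_C_mul,
      coeff_neg_one_pow_mul_X_pow (h1 k), mul_zero]
  have hA := coeff_eq_of_X_pow_dvd_sub (X_pow_dvd_tripleTailSum_one (n + 1)) (Nat.lt_succ_self n)
  have hB := coeff_eq_of_X_pow_dvd_sub (X_pow_dvd_tripleTailSum_add (n + 1) 0)
    (Nat.lt_succ_self n)
  have hS := congrArg (coeff n) (two_mul_sum_seriesDTerm n)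
  rw [pow_zero, one_mul, map_add] at hB
  rw [two_mul, map_add, map_sub, map_sub, ← D'_eq_coeff_sum] at hS
  simp only [zero_add] at hB
  linarith

/-! ### The combinatorial interpretation of `D'` -/

theorem X_pow_dvd_sub_mul_sub {a b c d : PowerSeries ℤ} {N : ℕ} (h : X ^ N ∣ a - b)
    (h' : X ^ N ∣ c - d) : X ^ N ∣ a * c - b * d := by
  have : a * c - b * d = (a - b) * c + b * (c - d) := by ring
  rw [this]
  exact dvd_add (h.mul_right _) (h'.mul_left _)

theorem prod_Ioc_mul_tailProd (s N : ℕ) :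
    (∏ i ∈ Finset.Ioc s (s + N), (1 - (X : PowerSeries ℤ) ^ i)) * tailProd (s + N + 1) =
      tailProd (s + 1) := by
  induction N with
  | zero => simp
  | succ N ih =>
    rw [← add_assoc, ← Finset.insert_Ioc_right_eq_Ioc_add_one (by omega),
      Finset.prod_insert (by simp), mul_right_comm, ← tailProd_eq, mul_comm, ih]

theorem X_pow_dvd_tailProd_sub_prod (s n : ℕ) :
    X ^ (n + 1) ∣ tailProd (s + 1) - ∏ i ∈ Finset.Ioc s (s + n), (1 - (X : PowerSeries ℤ) ^ i) := by
  have h := X_pow_dvd_tailProd_sub_one (show n + 1 ≤ s + n + 1 by omega)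
  convert h.mul_left (∏ i ∈ Finset.Ioc s (s + n), (1 - (X : PowerSeries ℤ) ^ i)) using 1
  linear_combination -prod_Ioc_mul_tailProd s n

theorem shiftProd_eq_prod_Ico (s : ℕ) :
    shiftProd s s = ∏ i ∈ Finset.Ico s (2 * s), (1 - (X : PowerSeries ℤ) ^ i) := by
  rw [shiftProd, qFactorial, Finset.prod_Ico_eq_prod_range, show 2 * s - s = s by omega]
  simp only [pow_add]

theorem prod_one_sub_X_pow (S : Finset ℕ) :
    ∏ i ∈ S, (1 - (X : PowerSeries ℤ) ^ i) =
      ∑ A ∈ S.powerset, (-1) ^ A.card * X ^ (∑ i ∈ A, i) := by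
  simp only [sub_eq_add_neg]
  rw [Finset.prod_one_add]
  refine Finset.sum_congr rfl fun A _ => ?_
  rw [Finset.prod_neg, Finset.prod_pow_eq_pow_sum]

/-- The finsets `(A, B, C, D)` of the larger overlined and of the non-overlined parts of pairs
with smallest part `s`, the parts being bounded by `s + n`. -/
def partData (n s : ℕ) : Finset ((Finset ℕ × Finset ℕ) × (Finset ℕ × Finset ℕ)) :=
  ((Finset.Ioc s (s + n)).powerset ×ˢ (Finset.Ioc s (s + n)).powerset) ×ˢ
    ((Finset.Ioc s (s + n)).powerset ×ˢ (Finset.Ico s (2 * s)).powerset)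

/-- The sum of the elements of four finsets. -/
def dataSum (d : (Finset ℕ × Finset ℕ) × (Finset ℕ × Finset ℕ)) : ℕ :=
  (∑ i ∈ d.1.1, i + ∑ i ∈ d.1.2, i) + (∑ i ∈ d.2.1, i + ∑ i ∈ d.2.2, i)

/-- The number of elements of four finsets. -/
def dataCard (d : (Finset ℕ × Finset ℕ) × (Finset ℕ × Finset ℕ)) : ℕ :=
  (d.1.1.card + d.1.2.card) + (d.2.1.card + d.2.2.card)

/-- The three infinite products generate the overlined parts `> s` of both components and the
non-overlined parts of the first; `(q^s;q)_s` generates the non-overlined parts of the second, and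
`q^{2s}` the two overlined `s`. Parts above `s + n` cannot affect the coefficient of `q^n`. -/
theorem coeff_seriesDTerm (n s : ℕ) : coeff n (seriesDTerm s) =
    ∑ d ∈ partData n s with 2 * s + dataSum d = n, (-1) ^ dataCard d := by
  have hP := X_pow_dvd_tailProd_sub_prod s n
  set P := ∏ i ∈ Finset.Ioc s (s + n), (1 - (X : PowerSeries ℤ) ^ i) with hPdef
  have h1 : X ^ (n + 1) ∣ seriesDTerm s -
      X ^ (2 * s) * ((P * P) * (P * shiftProd s s)) := by
    convert (X_pow_dvd_sub_mul_sub (X_pow_dvd_sub_mul_sub hP hP) hP).mul_left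
      (X ^ (2 * s) * shiftProd s s) using 1
    rw [seriesDTerm]
    ring
  rw [coeff_eq_of_X_pow_dvd_sub h1 (Nat.lt_succ_self n), shiftProd_eq_prod_Ico, hPdef,
    prod_one_sub_X_pow, prod_one_sub_X_pow, Finset.sum_mul_sum, ← Finset.sum_product',
    Finset.sum_mul_sum, ← Finset.sum_product', Finset.sum_mul_sum, ← Finset.sum_product',
    Finset.mul_sum, map_sum, Finset.sum_filter]
  refine Finset.sum_congr rfl fun d _ => ?_
  rw [show X ^ (2 * s) * ((-1 : PowerSeries ℤ) ^ d.1.1.card * X ^ (∑ i ∈ d.1.1, i) *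
      ((-1) ^ d.1.2.card * X ^ (∑ i ∈ d.1.2, i)) * ((-1) ^ d.2.1.card * X ^ (∑ i ∈ d.2.1, i) *
      ((-1) ^ d.2.2.card * X ^ (∑ i ∈ d.2.2, i)))) =
      C ((-1) ^ dataCard d) * X ^ (2 * s + dataSum d) by
    simp only [dataCard, dataSum, pow_add, map_mul, map_pow, map_neg, map_one]
    ring]
  rw [coeff_C_mul, coeff_X_pow]
  simp only [mul_ite, mul_one, mul_zero, eq_comm]

namespace Overpartition

/-- The overpartition with overlined parts `A` and non-overlined parts `B`, all positive. -/
def ofFinsets (A B : Finset ℕ) (hA : ∀ a ∈ A, 0 < a) (hB : ∀ b ∈ B, 0 < b) : Overpartition where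
  parts := A.val + B.val
  parts_pos a ha := (Multiset.mem_add.1 ha).elim (hA a) (hB a)
  overlined := A
  overlined_mem _ ha := Multiset.mem_add.2 (Or.inl ha)

theorem overlined_add_nonOverlined (l : Overpartition) :
    l.overlined.val + l.nonOverlined = l.parts :=
  add_tsub_cancel_of_le ((Multiset.le_iff_subset l.overlined.nodup).2 l.overlined_mem)

end Overpartition

theorem D₀_sub_D₁ (n : ℕ) : (D₀ n : ℤ) - D₁ n =
    ∑ p ∈ (pairsD_finite n).toFinset, (-1) ^ (p.1.numParts + p.2.numParts) := by
  classical
  have h₀ : D₀ n = ((pairsD_finite n).toFinset.filter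
      fun p => Even (p.1.numParts + p.2.numParts)).card := by
    rw [D₀, ← Set.ncard_coe_finset]
    congr 1
    ext p
    simp
  have h₁ : D₁ n = ((pairsD_finite n).toFinset.filter
      fun p => ¬ Even (p.1.numParts + p.2.numParts)).card := by
    rw [D₁, ← Set.ncard_coe_finset]
    congr 1
    ext p
    simp
  rw [← Finset.sum_filter_add_sum_filter_not _ (fun p => Even (p.1.numParts + p.2.numParts)),
    Finset.sum_congr rfl fun p hp => (Finset.mem_filter.1 hp).2.neg_one_pow,
    Finset.sum_congr (s₁ := Finset.filter (fun p => ¬ Even _) _) rfl fun p hp =>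
      (Nat.not_even_iff_odd.1 (Finset.mem_filter.1 hp).2).neg_one_pow, h₀, h₁]
  simp [sub_eq_add_neg]

/-- The finsets recording the parts of an overpartition pair with smallest part `s`, other than
the two overlined parts `s`. -/
def pairData (s : ℕ) (p : Overpartition × Overpartition) :
    (Finset ℕ × Finset ℕ) × (Finset ℕ × Finset ℕ) :=
  ((p.1.overlined.erase s, p.1.nonOverlined.toFinset),
    (p.2.overlined.erase s, p.2.nonOverlined.toFinset))

namespace Overpartition

theorem size_eq {l : Overpartition} {s : ℕ} (hs : s ∈ l.overlined) (hd : l.HasDistinctParts) :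
    l.size = s + (∑ i ∈ l.overlined.erase s, i + ∑ i ∈ l.nonOverlined.toFinset, i) := by
  have h : l.nonOverlined = l.nonOverlined.toFinset.val := by
    rw [Multiset.toFinset_val, Multiset.dedup_eq_self.2 hd]
  rw [size, ← overlined_add_nonOverlined, Multiset.sum_add, ← add_assoc,
    Finset.add_sum_erase _ (fun i => i) hs, Finset.sum_val]
  conv_lhs => rw [h, Finset.sum_val]
  simp only [id]

theorem numParts_eq {l : Overpartition} {s : ℕ} (hs : s ∈ l.overlined)
    (hd : l.HasDistinctParts) :
    l.numParts = 1 + ((l.overlined.erase s).card + l.nonOverlined.toFinset.card) := by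
  rw [numParts, ← overlined_add_nonOverlined, Multiset.card_add, Finset.card_val,
    Multiset.toFinset_card_of_nodup hd, ← Finset.card_erase_add_one hs]
  ring

theorem eq_of_erase_eq {l m : Overpartition} {s : ℕ} (hl : s ∈ l.overlined)
    (hm : s ∈ m.overlined) (hdl : l.HasDistinctParts) (hdm : m.HasDistinctParts)
    (h : l.overlined.erase s = m.overlined.erase s)
    (h' : l.nonOverlined.toFinset = m.nonOverlined.toFinset) : l = m := by
  have e : l.overlined = m.overlined := by
    rw [← Finset.insert_erase hl, h, Finset.insert_erase hm]
  have e' : l.nonOverlined = m.nonOverlined := by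
    rw [← Multiset.dedup_eq_self.2 hdl, ← Multiset.dedup_eq_self.2 hdm, ← Multiset.toFinset_val,
      h', Multiset.toFinset_val]
  exact Overpartition.ext
    (by rw [← overlined_add_nonOverlined, ← overlined_add_nonOverlined, e, e']) e

theorem nonOverlined_ofFinsets {A B : Finset ℕ} (hA : ∀ a ∈ A, 0 < a) (hB : ∀ b ∈ B, 0 < b) :
    (ofFinsets A B hA hB).nonOverlined = B.val :=
  add_tsub_cancel_left A.val B.val

theorem lt_of_mem_erase {l : Overpartition} {s a : ℕ} (h : l.IsSmallestPart s)
    (ha : a ∈ l.overlined.erase s) : s < a :=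
  lt_of_le_of_ne (h.2 (l.overlined_mem a (Finset.mem_of_mem_erase ha)))
    (Finset.ne_of_mem_erase ha).symm

theorem mem_le_size {l : Overpartition} {a : ℕ} (ha : a ∈ l.parts) : a ≤ l.size :=
  Multiset.le_sum_of_mem ha

end Overpartition

-- Removing the two overlined copies of `s` changes the number of parts by two, so the sign is
-- preserved under the bijection with `partData`.
open Overpartition in
theorem D'_eq_D₀_sub_D₁ (n : ℕ) : D' n = D₀ n - D₁ n := by
  have hD : D' n = ∑ s ∈ Finset.Ico 1 (n + 1), coeff n (seriesDTerm s) := by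
    rw [D'_eq_coeff_sum, map_sum, Finset.sum_Ico_eq_sum_range, Nat.add_sub_cancel]
    simp only [add_comm]
  rw [hD, Finset.sum_congr rfl fun s _ => coeff_seriesDTerm n s, Finset.sum_sigma', D₀_sub_D₁]
  symm
  have hsInf : ∀ {l : Overpartition} {s : ℕ}, l.IsSmallestPart s → sInf {a | a ∈ l.parts} = s :=
    fun h => h.csInf_eq
  -- Membership in `pairsD` only asserts that some `s` exists, so the map recovers it as the infimum
  -- of the parts.
  refine Finset.sum_bij
    (fun p _ => ⟨sInf {a | a ∈ p.1.parts}, pairData (sInf {a | a ∈ p.1.parts}) p⟩) ?_ ?_ ?_ ?_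
  · rintro ⟨l, m⟩ hp
    obtain ⟨hn, hl, hm, s, hsl, hsm, hol, hom, hnl, hnm⟩ := (pairsD_finite n).mem_toFinset.1 hp
    dsimp only at *
    rw [hsInf hsl]
    have hs0 : 0 < s := l.parts_pos s hsl.1
    rw [size_eq hol hl, size_eq hom hm] at hn
    have hbl : ∀ a ∈ l.parts, a ≤ n := fun a ha => by
      have := mem_le_size ha; rw [size_eq hol hl] at this; omega
    have hbm : ∀ a ∈ m.parts, a ≤ n := fun a ha => by
      have := mem_le_size ha; rw [size_eq hom hm] at this; omega
    have hno : ∀ {l : Overpartition} {a : ℕ}, a ∈ l.nonOverlined → a ∈ l.parts :=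
      fun ha => Multiset.mem_of_le (Multiset.sub_le_self _ _) ha
    have hsn' := hbl s hsl.1
    refine Finset.mem_sigma.2 ⟨Finset.mem_Ico.2 ⟨hs0, Nat.lt_succ_of_le hsn'⟩, Finset.mem_filter.2
      ⟨Finset.mem_product.2 ⟨Finset.mem_product.2 ⟨Finset.mem_powerset.2 ?_,
        Finset.mem_powerset.2 ?_⟩, Finset.mem_product.2 ⟨Finset.mem_powerset.2 ?_,
        Finset.mem_powerset.2 ?_⟩⟩, ?_⟩⟩
    · intro a ha
      have := hbl a (l.overlined_mem a (Finset.mem_of_mem_erase ha))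
      exact Finset.mem_Ioc.2 ⟨lt_of_mem_erase hsl ha, by omega⟩
    · intro a ha
      have ha := Multiset.mem_toFinset.1 ha
      have := hbl a (hno ha)
      exact Finset.mem_Ioc.2 ⟨hnl a ha, by omega⟩
    · intro a ha
      have := hbm a (m.overlined_mem a (Finset.mem_of_mem_erase ha))
      exact Finset.mem_Ioc.2 ⟨lt_of_mem_erase hsm ha, by omega⟩
    · intro a ha
      exact Finset.mem_Ico.2 (hnm a (Multiset.mem_toFinset.1 ha))
    · simp only [dataSum, pairData]
      omega
  · rintro ⟨l, m⟩ hp ⟨l', m'⟩ hp' heq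
    obtain ⟨-, hl, hm, s, hsl, hsm, hol, hom, -, -⟩ := (pairsD_finite n).mem_toFinset.1 hp
    obtain ⟨-, hl', hm', s', hsl', hsm', hol', hom', -, -⟩ := (pairsD_finite n).mem_toFinset.1 hp'
    dsimp only at *
    rw [hsInf hsl, hsInf hsl'] at heq
    obtain rfl : s = s' := congrArg Sigma.fst heq
    have hd := eq_of_heq (Sigma.mk.inj heq).2
    simp only [pairData, Prod.mk.injEq] at hd
    obtain ⟨⟨e1, e2⟩, e3, e4⟩ := hd
    rw [eq_of_erase_eq hol hol' hl hl' e1 e2, eq_of_erase_eq hom hom' hm hm' e3 e4]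
  · rintro ⟨s, ⟨A, B⟩, C, D⟩ hx
    simp only [Finset.mem_sigma, Finset.mem_filter, Finset.mem_Ico, partData,
      Finset.mem_product, Finset.mem_powerset] at hx
    obtain ⟨⟨hs0, -⟩, ⟨⟨hA, hB⟩, hC, hD⟩, hsum⟩ := hx
    have hA' : ∀ a ∈ A, s < a := fun a ha => (Finset.mem_Ioc.1 (hA ha)).1
    have hB' : ∀ a ∈ B, s < a := fun a ha => (Finset.mem_Ioc.1 (hB ha)).1
    have hC' : ∀ a ∈ C, s < a := fun a ha => (Finset.mem_Ioc.1 (hC ha)).1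
    have hD' : ∀ a ∈ D, a ∈ Set.Ico s (2 * s) := fun a ha => Finset.mem_Ico.1 (hD ha)
    have least : ∀ {A B : Finset ℕ} (hA : ∀ a ∈ insert s A, 0 < a) (hB : ∀ b ∈ B, 0 < b),
        (∀ a ∈ A, s < a) → (∀ b ∈ B, s ≤ b) → (ofFinsets (insert s A) B hA hB).IsSmallestPart s := by
      intro A B hA hB h h'
      refine ⟨Multiset.mem_add.2 (Or.inl (Finset.mem_insert_self s A)), fun a ha => ?_⟩
      rcases Multiset.mem_add.1 ha with ha | ha
      · rcases Finset.mem_insert.1 ha with rfl | ha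
        · exact le_rfl
        · exact (h a ha).le
      · exact h' a ha
    have pos : ∀ {A : Finset ℕ}, (∀ a ∈ A, s < a) → ∀ a ∈ insert s A, 0 < a := by
      intro A h a ha
      rcases Finset.mem_insert.1 ha with rfl | ha
      · exact hs0
      · exact (Nat.zero_le s).trans_lt (h a ha)
    have pB : ∀ a ∈ B, 0 < a := fun a ha => (Nat.zero_le s).trans_lt (hB' a ha)
    have pD : ∀ a ∈ D, 0 < a := fun a ha => lt_of_lt_of_le hs0 (hD' a ha).1
    have eA : (insert s A).erase s = A := Finset.erase_insert fun h => (hA' s h).false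
    have eC : (insert s C).erase s = C := Finset.erase_insert fun h => (hC' s h).false
    have hl := least (pos hA') pB hA' fun b hb => (hB' b hb).le
    have hm := least (pos hC') pD hC' fun b hb => (hD' b hb).1
    have dl : (ofFinsets (insert s A) B (pos hA') pB).HasDistinctParts := by
      rw [HasDistinctParts, nonOverlined_ofFinsets]; exact B.nodup
    have dm : (ofFinsets (insert s C) D (pos hC') pD).HasDistinctParts := by
      rw [HasDistinctParts, nonOverlined_ofFinsets]; exact D.nodup
    refine ⟨(ofFinsets (insert s A) B (pos hA') pB, ofFinsets (insert s C) D (pos hC') pD),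
      (pairsD_finite n).mem_toFinset.2 ⟨?_, dl, dm, s, hl, hm, Finset.mem_insert_self s A,
        Finset.mem_insert_self s C, ?_, ?_⟩, ?_⟩
    · rw [size_eq (Finset.mem_insert_self s A) dl, size_eq (Finset.mem_insert_self s C) dm,
        nonOverlined_ofFinsets, nonOverlined_ofFinsets]
      simp only [ofFinsets, eA, eC, Finset.val_toFinset]
      simp only [dataSum] at hsum
      omega
    · rw [nonOverlined_ofFinsets]; exact hB'
    · rw [nonOverlined_ofFinsets]; exact hD'
    · dsimp only
      rw [hsInf hl, pairData, nonOverlined_ofFinsets, nonOverlined_ofFinsets]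
      simp only [ofFinsets, eA, eC, Finset.val_toFinset]
  · rintro ⟨l, m⟩ hp
    obtain ⟨-, hl, hm, s, hsl, hsm, hol, hom, -, -⟩ := (pairsD_finite n).mem_toFinset.1 hp
    dsimp only at *
    rw [hsInf hsl, numParts_eq hol hl, numParts_eq hom hm]
    simp only [dataCard, pairData]
    ring

theorem mainTheorem10 (n : ℕ) (hn : 0 < n)
    (h : ¬ ∃ a b : ℕ, IsTriangular a ∧ IsTriangular b ∧ n = a + b) :
    D' n = 0 ∧ D₀ n = D₁ n := by
  have h0 := D'_eq_zero n h
  have h1 := D'_eq_D₀_sub_D₁ n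
  exact ⟨h0, by omega⟩
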